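/- Let $\mathbb{F}_q$ be a finite field with $q$ elements, $k=\mathbb{F}_q(\theta)$, let $k_\infty$ be the completion of $k$ at its infinite place, with the absolute value normalized by $|\theta|_\infty=q$, let $\mathbb{C}_\infty$ be the completion of an algebraic closure of $k_\infty$, and let $\overline{k}$ be the algebraic closure of $k$ in $\mathbb{C}_\infty$. Let $\overline{k}[\tau]$ be the twisted polynomial ring with $\tau x=x^q\tau$; a matrix over $\overline{k}[\tau]$ acts on column vectors over $\overline{k}$ by letting $\sum_i a_i\tau^i$ act as $x\mapsto\sum_i a_ix^{q^i}$. Let $r\ge 1$, let $\mathfrak{s}=(s_1,\dots,s_r)$ be positive integers and $\mathbf{u}=(u_1,\dots,u_r)\in\overline{k}^{\,r}$. Put $d_\ell=s_\ell+\cdots+s_r$ for $1\le\ell\le r$ and $d=d_1+\cdots+d_r$. Let $N\in\mathrm{Mat}_d(\overline{k})$ be the block diagonal matrix whose $\ell$-th diagonal block, of size $d_\ell\times d_\ell$, has entries $1$ directly above the diagonal and $0$ elsewhere. Let $E\in\mathrm{Mat}_d(\overline{k})$ be the block matrix whose $(\ell,m)$ block, of size $d_\ell\times d_m$, is zero for $\ell>m$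 and, for $\ell\le m$, has the entry $(-1)^{m-\ell}\prod_{e=\ell}^{m-1}u_e$ in its lower left corner and $0$ elsewhere. Let $G_{\mathfrak{s},\mathbf{u}}$ be the $t$-module of dimension $d$ over $\overline{k}$ given by the $\mathbb{F}_q$-algebra homomorphism $$[-]:\mathbb{F}_q[t]\to\mathrm{Mat}_d(\overline{k}[\tau]),\qquad [t]=\theta I_d+N+E\tau,$$ so that $G_{\mathfrak{s},\mathbf{u}}(\overline{k})=\overline{k}^{\,d}$ is an $\mathbb{F}_q[t]$-module through $a\cdot\mathbf{x}=[a](\mathbf{x})$. Suppose that $\tilde{\mathbf{u}}=(u_r,\dots,u_1)$ lies in $\mathbb{D}_{\tilde{\mathfrak{s}},\infty}$ for $\tilde{\mathfrak{s}}=(s_r,\dots,s_1)$, that is, $|u_r|_\infty<q^{s_rq/(q-1)}$ and $|u_i|_\infty\le q^{s_iq/(q-1)}$ for $1\le i\le r-1$. Then $G_{\mathfrak{s},\mathbf{u}}$ is regular: there is a positive integer $\nu$ such that for every nonzero $a\in\mathbb{F}_q[t]$ the $a$-torsion submodule of $G_{\mathfrak{s},\mathbf{u}}(\overline{k})$ is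 a free $\mathbb{F}_q[t]/(a)$-module of rank $\nu$. -/

import Mathlib

open scoped NNReal Polynomial

namespace AndersonT

noncomputable section

/-! ### The fields `k`, `k_∞`, `ℂ_∞` and `k̄`

`Fq` is a finite field with `q` elements, `k = RatFunc Fq` is `𝔽_q(θ)`, with `θ = RatFunc.X`. -/

section Fields

universe w

/-- `k_∞`, the completion of `k = 𝔽_q(θ)` at the infinite place. -/
def KInf (Fq : Type w) [Field Fq] : Type w :=
  @RatFunc.CompletionAtInfty Fq _ (Classical.decEq _)

section

variable (Fq : Type w) [Field Fq]

instance : Field (KInf Fq) :=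
  @RatFunc.CompletionAtInfty.instField Fq _ (Classical.decEq _)

instance : Algebra (RatFunc Fq) (KInf Fq) :=
  @RatFunc.CompletionAtInfty.instAlgebra Fq _ (Classical.decEq _)

instance : Valued (KInf Fq) (WithZero (Multiplicative ℤ)) :=
  @RatFunc.CompletionAtInfty.instValuedWithZeroMultiplicativeInt Fq _ (Classical.decEq _)

instance : CompleteSpace (KInf Fq) :=
  @UniformSpace.Completion.completeSpace (RatFunc Fq)
    (@RatFunc.CompletionAtInfty.instUniformSpace Fq _ (Classical.decEq _))

/-- The valuation on `k_∞` extends the valuation `exp (deg x)` on `k`. -/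
theorem valued_algebraMap (x : RatFunc Fq) :
    Valued.v (algebraMap (RatFunc Fq) (KInf Fq) x) =
      @RatFunc.inftyValuation Fq _ (Classical.decEq _) x :=
  @Valued.extensionValuation_apply_coe (RatFunc Fq) _ _ _
    (@RatFunc.inftyValued Fq _ (Classical.decEq _)) x

theorem valued_algebraMap_X :
    Valued.v (algebraMap (RatFunc Fq) (KInf Fq) RatFunc.X) = WithZero.exp (1 : ℤ) := by
  rw [valued_algebraMap]
  exact @RatFunc.inftyValuation.X Fq _ (Classical.decEq _)

end

variable (Fq : Type w) [Field Fq] [Fintype Fq]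

theorem one_lt_card : (1 : ℝ≥0) < (Fintype.card Fq : ℝ≥0) := by
  exact_mod_cast Fintype.one_lt_card

/-- The real absolute value on `k_∞` is normalized: an element of valuation `exp n` has absolute
value `q ^ n`, so that `|θ|_∞ = q`. -/
instance : (Valued.v : Valuation (KInf Fq) (WithZero (Multiplicative ℤ))).RankOne where
  hom' := (WithZeroMulInt.toNNReal (ne_zero_of_lt (one_lt_card Fq))).comp
    MonoidWithZeroHom.ValueGroup₀.embedding
  strictMono' := (WithZeroMulInt.toNNReal_strictMono (one_lt_card Fq)).comp
    MonoidWithZeroHom.ValueGroup₀.embedding_strictMono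
  exists_val_nontrivial := by
    refine ⟨algebraMap (RatFunc Fq) (KInf Fq) RatFunc.X, ?_, ?_⟩ <;>
      rw [valued_algebraMap_X] <;> decide

instance : NontriviallyNormedField (KInf Fq) :=
  Valued.toNontriviallyNormedField (KInf Fq) (WithZero (Multiplicative ℤ))

instance : IsUltrametricDist (KInf Fq) :=
  inferInstanceAs (@IsUltrametricDist (KInf Fq)
    (Valued.toNormedField (KInf Fq) (WithZero (Multiplicative ℤ))).toMetricSpace.toDist)

/-- A fixed algebraic closure of `k_∞`, with the unique extension of the absolute value. -/
def KInfBar : Type w := AlgebraicClosure (KInf Fq)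

instance : Field (KInfBar Fq) := inferInstanceAs (Field (AlgebraicClosure (KInf Fq)))

instance : Algebra (KInf Fq) (KInfBar Fq) :=
  inferInstanceAs (Algebra (KInf Fq) (AlgebraicClosure (KInf Fq)))

instance : IsAlgClosure (KInf Fq) (KInfBar Fq) :=
  inferInstanceAs (IsAlgClosure (KInf Fq) (AlgebraicClosure (KInf Fq)))

instance : Algebra.IsAlgebraic (KInf Fq) (KInfBar Fq) :=
  IsAlgClosure.isAlgebraic

instance : NormedField (KInfBar Fq) := spectralNorm.normedField (KInf Fq) (KInfBar Fq)

/-- `ℂ_∞`, the completion of the algebraic closure of `k_∞`. -/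
def CInf : Type w := UniformSpace.Completion (KInfBar Fq)

instance : NormedField (CInf Fq) :=
  inferInstanceAs (NormedField (UniformSpace.Completion (KInfBar Fq)))

instance : Algebra (KInfBar Fq) (CInf Fq) :=
  (UniformSpace.Completion.coeRingHom : KInfBar Fq →+* UniformSpace.Completion (KInfBar Fq)).toAlgebra

instance : Algebra (RatFunc Fq) (CInf Fq) :=
  ((algebraMap (KInfBar Fq) (CInf Fq)).comp ((algebraMap (KInf Fq) (KInfBar Fq)).comp
    (algebraMap (RatFunc Fq) (KInf Fq)))).toAlgebra

/-- `k̄`, the algebraic closure of `k` inside `ℂ_∞`. -/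
abbrev KBar : Type w := algebraicClosure (RatFunc Fq) (CInf Fq)

instance : Algebra Fq (KBar Fq) :=
  ((algebraMap (RatFunc Fq) (KBar Fq)).comp (algebraMap Fq (RatFunc Fq))).toAlgebra

/-- The element `θ` of `k̄`. -/
def thetaBar : KBar Fq := algebraMap (RatFunc Fq) (KBar Fq) RatFunc.X

end Fields

/-! ### Twisted polynomials

`R` is a commutative `𝔽_q`-algebra. -/

section Twisted

universe w z

variable (Fq : Type w) [Field Fq] [Fintype Fq] (R : Type z) [CommRing R] [Algebra Fq R]

/-- The action of `ℕ` on `R` through the powers of the `q`-th power Frobenius. -/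
@[reducible] def frobAction : MulSemiringAction (Multiplicative ℕ) R where
  smul n x := x ^ Fintype.card Fq ^ n.toAdd
  one_smul x := by
    change x ^ Fintype.card Fq ^ 0 = x
    rw [pow_zero, pow_one]
  mul_smul m n x := by
    change x ^ Fintype.card Fq ^ (m.toAdd + n.toAdd) =
      (x ^ Fintype.card Fq ^ n.toAdd) ^ Fintype.card Fq ^ m.toAdd
    rw [← pow_mul, ← pow_add, add_comm]
  smul_zero n := zero_pow (pow_ne_zero _ Fintype.card_ne_zero)
  smul_one n := one_pow _
  smul_add n x y := by
    have h : ∀ x : R, (FiniteField.frobeniusAlgHom Fq R ^ n.toAdd) x =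
        x ^ Fintype.card Fq ^ n.toAdd := fun x => by
      rw [AlgHom.coe_pow, FiniteField.coe_frobeniusAlgHom, pow_iterate]
    change (x + y) ^ Fintype.card Fq ^ n.toAdd =
      x ^ Fintype.card Fq ^ n.toAdd + y ^ Fintype.card Fq ^ n.toAdd
    rw [← h, ← h, ← h, map_add]
  smul_mul n x y := mul_pow _ _ _

theorem frobAction_smulCommClass :
    @SMulCommClass (Multiplicative ℕ) Fq R (frobAction Fq R).toSMul _ := by
  let _ := frobAction Fq R
  refine ⟨fun n c x => ?_⟩
  change (c • x) ^ Fintype.card Fq ^ n.toAdd = c • x ^ Fintype.card Fq ^ n.toAdd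
  rw [smul_pow, FiniteField.pow_card_pow]

/-- The ring `R[τ]` of twisted polynomials `∑ aᵢ τⁱ`, with `τ a = a ^ q τ`. -/
def TwistedPoly (_Fq : Type w) (R : Type z) [CommRing R] : Type z := SkewPolynomial R

instance : Ring (TwistedPoly Fq R) :=
  @SkewMonoidAlgebra.instRing R (Multiplicative ℕ) _ _ (frobAction Fq R)

instance : Algebra Fq (TwistedPoly Fq R) :=
  @SkewMonoidAlgebra.instAlgebraOfSMulCommClass Fq (Multiplicative ℕ) _ _ R _ _
    (frobAction Fq R) (frobAction_smulCommClass Fq R)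

variable {R}

/-- The twisted polynomial `a τⁿ`. -/
def TwistedPoly.monomial (n : ℕ) (a : R) : TwistedPoly Fq R := SkewPolynomial.monomial n a

variable {Fq}

/-- The coefficient of `τⁿ`. -/
def TwistedPoly.coeff (p : TwistedPoly Fq R) (n : ℕ) : R := SkewPolynomial.coeff p n

theorem TwistedPoly.coeff_monomial (m n : ℕ) (a : R) :
    (TwistedPoly.monomial Fq m a).coeff n = if m = n then a else 0 :=
  SkewPolynomial.coeff_monomial

theorem TwistedPoly.coeff_add (p p' : TwistedPoly Fq R) (n : ℕ) :
    (p + p').coeff n = p.coeff n + p'.coeff n :=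
  congrFun (congrArg DFunLike.coe
    (SkewMonoidAlgebra.coeff_add (k := R) (G := Multiplicative ℕ) p p')) (Multiplicative.ofAdd n)

theorem TwistedPoly.monomial_mul_monomial (m n : ℕ) (a b : R) :
    TwistedPoly.monomial Fq m a * TwistedPoly.monomial Fq n b =
      TwistedPoly.monomial Fq (m + n) (a * b ^ Fintype.card Fq ^ m) :=
  @SkewMonoidAlgebra.single_mul_single R (Multiplicative ℕ) _ _ (frobAction Fq R)
    (Multiplicative.ofAdd m) (Multiplicative.ofAdd n) a b

variable (Fq R)

theorem frobenius_pow_apply (n : ℕ) (x : R) :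
    ((FiniteField.frobeniusAlgHom Fq R).toLinearMap ^ n) x = x ^ Fintype.card Fq ^ n := by
  rw [Module.End.coe_pow, AlgHom.coe_toLinearMap, FiniteField.coe_frobeniusAlgHom, pow_iterate]

/-- A twisted polynomial `∑ aᵢ τⁱ` as the `𝔽_q`-linear endomorphism `x ↦ ∑ aᵢ x ^ (q ^ i)`. -/
def TwistedPoly.toEnd : TwistedPoly Fq R →ₐ[Fq] Module.End Fq R :=
  { @SkewMonoidAlgebra.liftNCRingHom R (Multiplicative ℕ) _ _ (frobAction Fq R) _ _
      (Algebra.lmul Fq R).toRingHom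
      (powersHom (Module.End Fq R) (FiniteField.frobeniusAlgHom Fq R).toLinearMap)
      (fun {x n} => by
        ext y
        change x ^ Fintype.card Fq ^ n.toAdd *
            ((FiniteField.frobeniusAlgHom Fq R).toLinearMap ^ n.toAdd) y =
          ((FiniteField.frobeniusAlgHom Fq R).toLinearMap ^ n.toAdd) (x * y)
        rw [frobenius_pow_apply, frobenius_pow_apply, mul_pow]) with
    commutes' := fun c => by
      ext y
      refine (LinearMap.congr_fun (SkewMonoidAlgebra.liftNC_single (G := Multiplicative ℕ) _ _ 1
        (algebraMap Fq R c)) y).trans ?_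
      rw [map_one, mul_one]
      exact (Algebra.smul_def c y).symm }

theorem TwistedPoly.toEnd_monomial (n : ℕ) (a x : R) :
    TwistedPoly.toEnd Fq R (TwistedPoly.monomial Fq n a) x = a * x ^ Fintype.card Fq ^ n := by
  refine (LinearMap.congr_fun (SkewMonoidAlgebra.liftNC_single (G := Multiplicative ℕ) _ _
    (Multiplicative.ofAdd n) a) x).trans ?_
  change a * ((FiniteField.frobeniusAlgHom Fq R).toLinearMap ^ n) x = _
  rw [frobenius_pow_apply]

variable (ι : Type) [Fintype ι] [DecidableEq ι]

/-- A matrix `M` over `R[τ]` as an `𝔽_q`-linear endomorphism of `R^ι`. -/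
def matToEnd : Matrix ι ι (TwistedPoly Fq R) →ₐ[Fq] Module.End Fq (ι → R) :=
  (endVecAlgEquivMatrixEnd ι Fq Fq R).symm.toAlgHom.comp (TwistedPoly.toEnd Fq R).mapMatrix

theorem matToEnd_apply (M : Matrix ι ι (TwistedPoly Fq R)) (x : ι → R) (i : ι) :
    matToEnd Fq R ι M x i = ∑ j, TwistedPoly.toEnd Fq R (M i j) (x j) :=
  rfl

end Twisted

/-! ### `t`-modules -/

section TModules

universe w z

/-- A `t`-module over `R`, of dimension `#ι` with coordinates indexed by `ι`: an `𝔽_q`-algebra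
homomorphism `[-] : 𝔽_q[t] → Mat_ι(R[τ])` such that `∂[t] - θ` is nilpotent, where `∂[a]` is the
matrix of constant coefficients of `[a]`. -/
structure TModule (Fq : Type w) [Field Fq] [Fintype Fq] {R : Type z} [CommRing R] [Algebra Fq R]
    (θ : R) (ι : Type) [Fintype ι] [DecidableEq ι] where
  /-- the map `a ↦ [a]` -/
  op : Fq[X] →ₐ[Fq] Matrix ι ι (TwistedPoly Fq R)
  isNilpotent_sub : IsNilpotent ((op Polynomial.X).map (fun p => p.coeff 0) - θ • 1)

variable {Fq : Type w} [Field Fq] [Fintype Fq] {R : Type z} [CommRing R] [Algebra Fq R] {θ : R}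
  {ι : Type} [Fintype ι] [DecidableEq ι]

/-- The group `G(R) = R^ι` of `R`-points of a `t`-module `G` over `R`. -/
def TModule.Points (_G : TModule Fq θ ι) : Type z := ι → R

instance (G : TModule Fq θ ι) : AddCommGroup G.Points := inferInstanceAs (AddCommGroup (ι → R))

/-- The `𝔽_q[t]`-module structure `a • x = [a](x)` on `G(R)`. -/
instance (G : TModule Fq θ ι) : Module Fq[X] G.Points :=
  letI : Module (Module.End Fq (ι → R)) G.Points :=
    inferInstanceAs (Module (Module.End Fq (ι → R)) (ι → R))
  Module.compHom G.Points ((matToEnd Fq R ι).comp G.op).toRingHom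

/-- The coordinates of a point. -/
def TModule.coord (G : TModule Fq θ ι) : G.Points ≃+ (ι → R) := AddEquiv.refl (ι → R)

theorem TModule.coord_smul (G : TModule Fq θ ι) (a : Fq[X]) (x : G.Points) :
    G.coord (a • x) = matToEnd Fq R ι (G.op a) (G.coord x) := rfl

/-- A `t`-module `G` is regular if, for some positive integer `ν`, the `a`-torsion of its points is
free of rank `ν` over `𝔽_q[t]/(a)` for every nonzero `a`. -/
def TModule.IsRegular (G : TModule Fq θ ι) : Prop :=
  ∃ ν : ℕ, 0 < ν ∧ ∀ a : Fq[X], a ≠ 0 →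
    Nonempty (Submodule.torsionBy Fq[X] G.Points a ≃ₗ[Fq[X] ⧸ Ideal.span {a}]
      (Fin ν → Fq[X] ⧸ Ideal.span {a}))

end TModules

/-! ### The `t`-module `G_{s,u}` -/

section Construction

universe w z

/-- `d_ℓ = s_ℓ + ⋯ + s_r`. -/
def blockDim {r : ℕ} (s : Fin r → ℕ) (l : Fin r) : ℕ := ∑ i ∈ Finset.Ici l, s i

/-- The index set of size `d = d_1 + ⋯ + d_r`; `⟨ℓ, i⟩` is the `i`-th index of the `ℓ`-th block. -/
abbrev BlockIdx {r : ℕ} (s : Fin r → ℕ) : Type := (l : Fin r) × Fin (blockDim s l)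

variable {R : Type z} [CommRing R] {r : ℕ} (s : Fin r → ℕ) (u : Fin r → R)

/-- The block diagonal matrix `N` with blocks `N_ℓ` having ones directly above the diagonal. -/
def matN : Matrix (BlockIdx s) (BlockIdx s) R := fun a b =>
  if a.1 = b.1 ∧ (a.2 : ℕ) + 1 = b.2 then 1 else 0

/-- The block upper triangular matrix `E`: for `ℓ ≤ m` the only nonzero entry of `E[ℓm]` is
`(-1) ^ (m - ℓ) * ∏_{ℓ ≤ e < m} u_e`, in the last row and the first column. -/
def matE : Matrix (BlockIdx s) (BlockIdx s) R := fun a b =>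
  if a.1 ≤ b.1 ∧ (a.2 : ℕ) + 1 = blockDim s a.1 ∧ (b.2 : ℕ) = 0 then
    (-1) ^ ((b.1 : ℕ) - (a.1 : ℕ)) * ∏ e ∈ Finset.Ico a.1 b.1, u e
  else 0

variable (R) in
theorem isNilpotent_matN : IsNilpotent (matN s : Matrix (BlockIdx s) (BlockIdx s) R) := by
  have h : ∀ (k : ℕ) (a b : BlockIdx s), (a.2 : ℕ) + k ≠ b.2 →
      ((matN s : Matrix (BlockIdx s) (BlockIdx s) R) ^ k) a b = 0 := by
    intro k
    induction k with
    | zero =>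
      intro a b hab
      rw [pow_zero, Matrix.one_apply_ne]
      rintro rfl
      exact hab rfl
    | succ k ih =>
      intro a b hab
      rw [pow_succ, Matrix.mul_apply]
      refine Finset.sum_eq_zero fun c _ => ?_
      by_cases hc : (a.2 : ℕ) + k = c.2
      · have : ¬ (c.1 = b.1 ∧ (c.2 : ℕ) + 1 = b.2) := by omega
        rw [matN, if_neg this, mul_zero]
      · rw [ih a c hc, zero_mul]
  refine ⟨∑ l, blockDim s l, ?_⟩
  ext a b
  refine h _ a b (fun hab => ?_)
  have h1 := b.2.isLt
  have h2 : blockDim s b.1 ≤ ∑ l, blockDim s l :=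
    Finset.single_le_sum (fun _ _ => Nat.zero_le _) (Finset.mem_univ _)
  omega

variable (Fq : Type w) [Field Fq] [Fintype Fq] [Algebra Fq R] (θ : R)

/-- `[t] = θ I_d + N + E τ`. -/
def matT : Matrix (BlockIdx s) (BlockIdx s) (TwistedPoly Fq R) :=
  (θ • (1 : Matrix (BlockIdx s) (BlockIdx s) R) + matN s).map (TwistedPoly.monomial Fq 0) +
    (matE s u).map (TwistedPoly.monomial Fq 1)

/-- The `t`-module `G_{s,u}`, given by `[t] = θ I_d + N + E τ`. -/
def tModuleG : TModule Fq θ (BlockIdx s) where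
  op := Polynomial.aeval (matT s u Fq θ)
  isNilpotent_sub := by
    have h : ((Polynomial.aeval (matT s u Fq θ) (Polynomial.X : Fq[X])).map
        (fun p => p.coeff 0) - θ • 1) = matN s := by
      rw [Polynomial.aeval_X]
      ext a b
      simp [matT, TwistedPoly.coeff_add, TwistedPoly.coeff_monomial]
    rw [h]
    exact isNilpotent_matN R s

end Construction

/-! ### The domain `𝔻_{s,∞}` -/

section Domain

universe w

/-- The set of `z ∈ ℂ_∞^r` with `|z_1|_∞ < q ^ (s_1 q / (q - 1))` and
`|z_i|_∞ ≤ q ^ (s_i q / (q - 1))` for `2 ≤ i ≤ r`. -/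
def domainInf (Fq : Type w) [Field Fq] [Fintype Fq] {r : ℕ} (s : Fin r → ℕ) :
    Set (Fin r → CInf Fq) :=
  {z | ∀ i : Fin r,
    ((i : ℕ) = 0 → ‖z i‖ <
      (Fintype.card Fq : ℝ) ^ ((s i : ℝ) * Fintype.card Fq / ((Fintype.card Fq : ℝ) - 1))) ∧
    ((i : ℕ) ≠ 0 → ‖z i‖ ≤
      (Fintype.card Fq : ℝ) ^ ((s i : ℝ) * Fintype.card Fq / ((Fintype.card Fq : ℝ) - 1)))}

end Domain

end

end AndersonT

/-!
The `t`-module `G = G_{s,u}` is regular of rank `r`, for a purely algebraic reason: `k̄` is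
algebraically closed and `θ` is transcendental over `𝔽_q`.

Write `A = 𝔽_q[t]` and let `a ≠ 0`. An `a`-torsion point `x` is the same as an `A`-linear map
`A/a → G(k̄)`, `b ↦ [b](x)`, that is, a family of `𝔽_q`-linear coordinate functions `A/a → k̄`. The
shape `[t] = θ + N + E τ` says that inside a block each coordinate function is obtained from the
preceding one by applying `t - θ`, and that the functions `F_1, …, F_r` at the heads of the blocks
satisfy `(t - θ) ^ d_l F_l = ∑ₘ e_{lm} F_m ^ q`, where `(e_{lm})` is unipotent upper triangular. So
`G[a]` is in bijection with the solutions of this Frobenius equation in `Hom_{𝔽_q}(A/a, k̄) ^ r`, a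
`k̄`-vector space of dimension `r * deg a` (`torsionCoord_mem_frobSolutions`,
`exists_torsionCoord_eq`). On it `t - θ` is invertible, because `a(θ) ≠ 0`; so the solutions are the
fixed vectors of an injective Frobenius-semilinear map. By Lang's theorem
(`span_fixedSet_eq_top`) such a map has a basis of fixed vectors, so there are `q ^ (r * deg a)`
solutions (`card_fixedSet`), and `#G[a] = #(A/a) ^ r` (`card_torsionBy`).

These counts, for all `a`, force `G[a]` to be free (`nonempty_torsionBy_equiv`): for a prime
`p ∣ a` the module `G[a] / p G[a]` has as many elements as `G[p]`, so it is generated by `r`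
elements; by the Chinese remainder theorem `r` elements generate `G[a]`, and the resulting
surjection `(A/a) ^ r → G[a]` is bijective since both sides have the same number of elements.
-/

namespace AndersonT

/-! ### Frobenius-semilinear maps over an algebraically closed field -/

section Lang

open Polynomial

variable {K : Type*} [Field K] {V : Type*} [AddCommGroup V] [Module K V] {q : ℕ}

theorem pow_card_eq_self_iff (Fq : Type*) [Field Fq] [Fintype Fq] [Algebra Fq K] (x : K) :
    x ^ Fintype.card Fq = x ↔ x ∈ Set.range (algebraMap Fq K) := by
  classical
  constructor
  · intro hx
    have hne : (X ^ Fintype.card Fq - X : K[X]) ≠ 0 :=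
      FiniteField.X_pow_card_sub_X_ne_zero K Fintype.one_lt_card
    have hsub : Finset.univ.image (algebraMap Fq K) ⊆
        (X ^ Fintype.card Fq - X : K[X]).roots.toFinset := by
      intro y hy
      obtain ⟨c, -, rfl⟩ := Finset.mem_image.1 hy
      rw [Multiset.mem_toFinset, mem_roots hne, IsRoot.def, eval_sub, eval_pow, eval_X,
        ← map_pow, FiniteField.pow_card, sub_self]
    have hcard : (X ^ Fintype.card Fq - X : K[X]).roots.toFinset.card ≤
        (Finset.univ.image (algebraMap Fq K)).card := by
      rw [Finset.card_image_of_injective _ (algebraMap Fq K).injective, Finset.card_univ]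
      refine (Multiset.toFinset_card_le _).trans ((card_roots' _).trans ?_)
      rw [FiniteField.X_pow_card_sub_X_natDegree_eq K Fintype.one_lt_card]
    have hx' : x ∈ (X ^ Fintype.card Fq - X : K[X]).roots.toFinset := by
      rw [Multiset.mem_toFinset, mem_roots hne, IsRoot.def, eval_sub, eval_pow, eval_X, hx,
        sub_self]
    rw [← Finset.eq_of_subset_of_card_le hsub hcard] at hx'
    obtain ⟨c, -, hc⟩ := Finset.mem_image.1 hx'
    exact ⟨c, hc⟩
  · rintro ⟨c, rfl⟩
    rw [← map_pow, FiniteField.pow_card]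

/-- The fixed points of an additive endomorphism. -/
def fixedSet (φ : V →+ V) : Set V := {v | φ v = v}

/-- The span of `v, φ v, …, φ ^ (n - 1) v`. -/
def iterateSpan (K : Type*) [Field K] [Module K V] (φ : V →+ V) (v : V) (n : ℕ) :
    Submodule K V :=
  Submodule.span K (Set.range fun i : Fin n => φ^[i] v)

theorem mem_iterateSpan_iff (φ : V →+ V) (v : V) (n : ℕ) (w : V) :
    w ∈ iterateSpan K φ v n ↔ ∃ c : ℕ → K, w = ∑ i ∈ Finset.range n, c i • φ^[i] v := by
  rw [iterateSpan, Submodule.mem_span_range_iff_exists_fun]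
  constructor
  · rintro ⟨c, rfl⟩
    refine ⟨fun i => if h : i < n then c ⟨i, h⟩ else 0, ?_⟩
    rw [Finset.sum_range]
    simp
  · rintro ⟨c, rfl⟩
    exact ⟨fun i => c i, by rw [Finset.sum_range]⟩

theorem exists_iterate_mem_iterateSpan [FiniteDimensional K V] (φ : V →+ V) (v : V) :
    ∃ n, φ^[n] v ∈ iterateSpan K φ v n := by
  have hmono : Monotone (iterateSpan K φ v) := by
    intro m n hmn
    refine Submodule.span_mono ?_
    rintro _ ⟨i, rfl⟩
    exact ⟨⟨i, i.2.trans_le hmn⟩, rfl⟩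
  obtain ⟨n, hn⟩ := monotone_stabilizes_iff_noetherian.2
    (inferInstance : IsNoetherian K V) ⟨_, hmono⟩
  refine ⟨n, ?_⟩
  have h : iterateSpan K φ v n = iterateSpan K φ v (n + 1) := hn (n + 1) n.le_succ
  rw [h]
  exact Submodule.subset_span ⟨⟨n, n.lt_succ_self⟩, rfl⟩

/-- If `φⁿ v = ∑_{i < n} cᵢ φⁱ v`, then `∑_{i < n} yᵢ φⁱ v` is fixed by a Frobenius-semilinear `φ`
as soon as `y₀ = c₀ x ^ q` and `yᵢ₊₁ = yᵢ ^ q + cᵢ₊₁ x ^ q` with `x = yₙ₋₁`. The polynomial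
`fixedCoeff q c i` expresses `yᵢ` in terms of `x`. -/
noncomputable def fixedCoeff (q : ℕ) (c : ℕ → K) : ℕ → K[X]
  | 0 => C (c 0) * X ^ q
  | i + 1 => fixedCoeff q c i ^ q + C (c (i + 1)) * X ^ q

theorem one_lt_natDegree_fixedCoeff (hq : 1 < q) {c : ℕ → K} (hc : c 0 ≠ 0) (i : ℕ) :
    1 < (fixedCoeff q c i).natDegree := by
  induction i with
  | zero => rwa [fixedCoeff, natDegree_C_mul_X_pow _ _ hc]
  | succ i ih =>
    have h1 : q < (fixedCoeff q c i ^ q).natDegree := by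
      rw [natDegree_pow]
      nlinarith
    rw [fixedCoeff, natDegree_add_eq_left_of_natDegree_lt]
    · omega
    · exact (natDegree_C_mul_X_pow_le _ _).trans_lt h1

theorem X_sq_dvd_fixedCoeff (hq : 1 < q) (c : ℕ → K) (i : ℕ) :
    X ^ 2 ∣ fixedCoeff q c i := by
  have h : (X : K[X]) ^ 2 ∣ X ^ q := pow_dvd_pow X hq
  induction i with
  | zero => exact h.mul_left _
  | succ i ih =>
    exact dvd_add (ih.trans (dvd_pow_self _ (by omega))) (h.mul_left _)

/-- The polynomial `fixedCoeff q c i - X` has the form `X * (X * g - 1)` with `g ≠ 0`, so it has a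
nonzero root. -/
theorem exists_ne_zero_eval_fixedCoeff [IsAlgClosed K] (hq : 1 < q) {c : ℕ → K}
    (hc : c 0 ≠ 0) (i : ℕ) : ∃ x : K, x ≠ 0 ∧ (fixedCoeff q c i).eval x = x := by
  obtain ⟨g, hg⟩ := X_sq_dvd_fixedCoeff hq c i
  have hdeg := one_lt_natDegree_fixedCoeff hq hc i
  have hg0 : g ≠ 0 := by
    rintro rfl
    simp [hg] at hdeg
  have hne : (X * g - 1).degree ≠ 0 := by
    refine degree_ne_of_natDegree_ne ?_
    have h1 : (1 : K[X]) = C 1 := rfl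
    rw [h1, natDegree_sub_C, natDegree_X_mul hg0]
    exact Nat.succ_ne_zero _
  obtain ⟨x, hx⟩ := IsAlgClosed.exists_root _ hne
  have hx1 : x * g.eval x = 1 := by
    rw [IsRoot.def, eval_sub, eval_mul, eval_X, eval_one] at hx
    exact sub_eq_zero.1 hx
  refine ⟨x, left_ne_zero_of_mul_eq_one hx1, ?_⟩
  rw [hg, eval_mul, eval_pow, eval_X, pow_two, mul_assoc, hx1, mul_one]

/-- An injective Frobenius-semilinear endomorphism has a nonzero fixed vector, found in the span
of the iterates of any nonzero vector. -/
theorem exists_fixed_ne_zero [IsAlgClosed K] [FiniteDimensional K V] (φ : V →+ V)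
    (hq : 1 < q) (hφ : ∀ (c : K) (v : V), φ (c • v) = c ^ q • φ v)
    (hinj : Function.Injective φ) {v : V} (hv : v ≠ 0) :
    ∃ w, w ≠ 0 ∧ φ w = w := by
  classical
  have hex := exists_iterate_mem_iterateSpan (K := K) φ v
  obtain ⟨c, hc⟩ := (mem_iterateSpan_iff φ v _ _).1 (Nat.find_spec hex)
  have hmin : ∀ m, m < Nat.find hex → φ^[m] v ∉ iterateSpan K φ v m :=
    fun m hm => Nat.find_min hex hm
  generalize Nat.find hex = n at hc hmin
  obtain _ | n := n
  · simp [hv] at hc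
  -- otherwise the relation could be divided by `φ`, against the minimality of `n + 1`
  have hc0 : c 0 ≠ 0 := by
    intro h0
    refine hmin n n.lt_succ_self ((mem_iterateSpan_iff φ v n _).2 ?_)
    choose d hd using fun i => IsAlgClosed.exists_pow_nat_eq (c (i + 1)) (zero_lt_one.trans hq)
    refine ⟨d, hinj ?_⟩
    rw [← Function.iterate_succ_apply' φ, hc, Finset.sum_range_succ', h0, zero_smul, add_zero,
      map_sum]
    refine Finset.sum_congr rfl fun i _ => ?_
    rw [hφ, hd, Function.iterate_succ_apply' φ]
  obtain ⟨x, hx0, hx⟩ := exists_ne_zero_eval_fixedCoeff hq hc0 n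
  set y : ℕ → K := fun i => (fixedCoeff (q) c i).eval x with hy
  have hyn : y n = x := hx
  have hy0 : y 0 = x ^ q * c 0 := by
    simp only [hy, fixedCoeff, eval_mul, eval_C, eval_pow, eval_X]
    rw [mul_comm]
  have hys : ∀ i, y (i + 1) = y i ^ q + x ^ q * c (i + 1) := by
    intro i
    simp only [hy, fixedCoeff, eval_add, eval_mul, eval_C, eval_pow, eval_X]
    rw [mul_comm (c (i + 1))]
  refine ⟨∑ i ∈ Finset.range (n + 1), y i • φ^[i] v, ?_, ?_⟩
  · intro h
    refine hmin n n.lt_succ_self ((mem_iterateSpan_iff φ v n _).2 ⟨fun i => -x⁻¹ * y i, ?_⟩)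
    rw [Finset.sum_range_succ, hyn] at h
    have h2 : x • φ^[n] v = -∑ i ∈ Finset.range n, y i • φ^[i] v := eq_neg_of_add_eq_zero_right h
    simp_rw [mul_smul]
    rw [← Finset.smul_sum, neg_smul, ← smul_neg, ← h2, smul_smul, inv_mul_cancel₀ hx0, one_smul]
  · rw [map_sum, Finset.sum_range_succ, hφ, ← Function.iterate_succ_apply' φ, hyn, hc,
      Finset.smul_sum]
    rw [Finset.sum_range_succ' (fun i => x ^ q • c i • φ^[i] v),
      Finset.sum_range_succ' (fun i => y i • φ^[i] v), ← add_assoc, ← Finset.sum_add_distrib, hy0,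
      smul_smul]
    congr 1
    refine Finset.sum_congr rfl fun i _ => ?_
    rw [hφ, ← Function.iterate_succ_apply' φ, hys, add_smul, smul_smul]

/-- On the span of its fixed vectors, a Frobenius-semilinear endomorphism is in coordinates the
standard Frobenius, so that `φ - 1` is surjective there. -/
theorem exists_sub_eq_of_mem_span_fixedSet [IsAlgClosed K] (φ : V →+ V)
    (hq : 1 < q) (hφ : ∀ (c : K) (v : V), φ (c • v) = c ^ q • φ v) {w : V}
    (hw : w ∈ Submodule.span K (fixedSet φ)) :
    ∃ v ∈ Submodule.span K (fixedSet φ), φ v - v = w := by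
  induction hw using Submodule.closure_induction with
  | zero => exact ⟨0, zero_mem _, by simp⟩
  | add x y _ _ hx hy =>
    obtain ⟨v, hv, rfl⟩ := hx
    obtain ⟨v', hv', rfl⟩ := hy
    exact ⟨v + v', add_mem hv hv', by rw [map_add]; abel⟩
  | smul_mem c x hx =>
    have hne : (X ^ q - X - C c : K[X]).degree ≠ 0 := by
      refine degree_ne_of_natDegree_ne ?_
      rw [natDegree_sub_C, FiniteField.X_pow_card_sub_X_natDegree_eq K hq]
      exact ne_zero_of_lt hq
    obtain ⟨b, hb⟩ := IsAlgClosed.exists_root _ hne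
    simp only [IsRoot.def, eval_sub, eval_pow, eval_X, eval_C] at hb
    refine ⟨b • x, Submodule.smul_mem _ _ (Submodule.subset_span hx), ?_⟩
    rw [hφ, show φ x = x from hx, ← sub_smul, sub_eq_zero.1 hb]

theorem exists_eq_of_mem_span_fixedSet [IsAlgClosed K] (φ : V →+ V)
    (hq : 1 < q) (hφ : ∀ (c : K) (v : V), φ (c • v) = c ^ q • φ v) {w : V}
    (hw : w ∈ Submodule.span K (fixedSet φ)) :
    ∃ v ∈ Submodule.span K (fixedSet φ), φ v = w := by
  induction hw using Submodule.closure_induction with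
  | zero => exact ⟨0, zero_mem _, map_zero _⟩
  | add x y _ _ hx hy =>
    obtain ⟨v, hv, rfl⟩ := hx
    obtain ⟨v', hv', rfl⟩ := hy
    exact ⟨v + v', add_mem hv hv', map_add _ _ _⟩
  | smul_mem c x hx =>
    obtain ⟨b, hb⟩ := IsAlgClosed.exists_pow_nat_eq c (zero_lt_one.trans hq)
    exact ⟨b • x, Submodule.smul_mem _ _ (Submodule.subset_span hx), by
      rw [hφ, hb, show φ x = x from hx]⟩

theorem map_mem_span_fixedSet (φ : V →+ V)
    (hφ : ∀ (c : K) (v : V), φ (c • v) = c ^ q • φ v) {w : V}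
    (hw : w ∈ Submodule.span K (fixedSet φ)) : φ w ∈ Submodule.span K (fixedSet φ) := by
  induction hw using Submodule.span_induction with
  | mem x hx => exact Submodule.subset_span (by rwa [show φ x = x from hx])
  | zero => simp
  | add x y _ _ hx hy => simpa using add_mem hx hy
  | smul c x _ hx => simpa [hφ] using Submodule.smul_mem _ _ hx

/-- Lang's theorem for `GL_n`: the fixed vectors of an injective Frobenius-semilinear endomorphism
span the space. Otherwise the quotient by their span has a nonzero fixed vector, which lifts to a
fixed vector since `φ - 1` is surjective on the span. -/
theorem span_fixedSet_eq_top [IsAlgClosed K] [FiniteDimensional K V] (φ : V →+ V)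
    (hq : 1 < q) (hφ : ∀ (c : K) (v : V), φ (c • v) = c ^ q • φ v)
    (hinj : Function.Injective φ) : Submodule.span K (fixedSet φ) = ⊤ := by
  set W := Submodule.span K (fixedSet φ) with hW
  let ψ : (V ⧸ W) →+ (V ⧸ W) :=
    QuotientAddGroup.map W.toAddSubgroup W.toAddSubgroup φ
      (fun w hw => map_mem_span_fixedSet φ hφ hw)
  have hψ : ∀ v : V, ψ (W.mkQ v) = W.mkQ (φ v) := fun v => rfl
  by_contra hne
  obtain ⟨v, hv⟩ : ∃ v, v ∉ W := by
    by_contra! h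
    exact hne (Submodule.eq_top_iff'.2 h)
  obtain ⟨z, hz0, hz⟩ : ∃ z, z ≠ 0 ∧ ψ z = z := by
    refine exists_fixed_ne_zero (K := K) ψ hq ?_ ?_ (v := W.mkQ v) ?_
    · intro c x
      obtain ⟨x, rfl⟩ := W.mkQ_surjective x
      rw [← map_smul, hψ, hφ, map_smul, hψ]
    · rw [injective_iff_map_eq_zero]
      intro x hx
      obtain ⟨x, rfl⟩ := W.mkQ_surjective x
      rw [hψ, Submodule.mkQ_apply, Submodule.Quotient.mk_eq_zero] at hx
      obtain ⟨y, hy, hxy⟩ := exists_eq_of_mem_span_fixedSet φ hq hφ hx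
      rw [Submodule.mkQ_apply, Submodule.Quotient.mk_eq_zero, ← hinj hxy]
      exact hy
    · rwa [Ne, Submodule.mkQ_apply, Submodule.Quotient.mk_eq_zero]
  obtain ⟨x, rfl⟩ := W.mkQ_surjective z
  rw [hψ, ← sub_eq_zero, ← map_sub, Submodule.mkQ_apply, Submodule.Quotient.mk_eq_zero] at hz
  obtain ⟨y, hy, hxy⟩ := exists_sub_eq_of_mem_span_fixedSet φ hq hφ hz
  refine hz0 ((Submodule.Quotient.mk_eq_zero W).2 ?_)
  have hfix : x - y ∈ fixedSet φ := by
    change φ (x - y) = x - y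
    rw [map_sub, sub_eq_sub_iff_sub_eq_sub, hxy]
  simpa using add_mem (Submodule.subset_span hfix) hy

/-- In a basis of fixed vectors, the fixed vectors are those with coordinates in `𝔽_q`. -/
theorem card_fixedSet {Fq : Type*} [Field Fq] [Fintype Fq] [Algebra Fq K] [IsAlgClosed K]
    [FiniteDimensional K V] (φ : V →+ V)
    (hφ : ∀ (c : K) (v : V), φ (c • v) = c ^ Fintype.card Fq • φ v)
    (hinj : Function.Injective φ) :
    Nat.card (fixedSet φ) = Fintype.card Fq ^ Module.finrank K V := by
  classical
  let b := Module.Basis.ofSpan (span_fixedSet_eq_top φ Fintype.one_lt_card hφ hinj).ge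
  have hb : ∀ i, φ (b i) = b i := fun i =>
    Module.Basis.ofSpan_subset (span_fixedSet_eq_top φ Fintype.one_lt_card hφ hinj).ge ⟨i, rfl⟩
  let _ : Fintype ↑((linearIndepOn_empty K id).extend (Set.empty_subset (fixedSet φ))) :=
    FiniteDimensional.fintypeBasisIndex b
  have hmap : ∀ v i, b.repr (φ v) i = b.repr v i ^ Fintype.card Fq := by
    intro v i
    have h : φ v = ∑ j, b.repr v j ^ Fintype.card Fq • b j := by
      conv_lhs => rw [← b.sum_repr v]
      simp_rw [map_sum, hφ, hb]
    rw [h, b.repr_sum_self]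
  let f : (↑((linearIndepOn_empty K id).extend (Set.empty_subset (fixedSet φ))) → Fq) →
      fixedSet φ := fun c => ⟨∑ i, algebraMap Fq K (c i) • b i, by
    change φ _ = _
    simp_rw [map_sum, hφ, hb, ← map_pow, FiniteField.pow_card]⟩
  have hf : Function.Bijective f := by
    constructor
    · intro c c' h
      have h1 : (f c : V) = f c' := congrArg _ h
      funext i
      have h2 := congrArg (fun v => b.repr v i) h1
      simp only [f, b.repr_sum_self] at h2
      exact (algebraMap Fq K).injective h2
    · rintro ⟨v, hv⟩
      have h1 : ∀ i, ∃ c, algebraMap Fq K c = b.repr v i := by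
        intro i
        refine (pow_card_eq_self_iff Fq _).1 ?_
        rw [← hmap, show φ v = v from hv]
      choose c hc using h1
      refine ⟨c, Subtype.ext ?_⟩
      simp only [f, hc]
      exact b.sum_repr v
  rw [← Nat.card_congr (Equiv.ofBijective f hf), Nat.card_fun, Nat.card_eq_fintype_card,
    Nat.card_eq_fintype_card, Module.finrank_eq_card_basis b]

end Lang

/-! ### Freeness of torsion submodules by counting -/

section Counting

variable {A : Type*} [CommRing A] {N : Type*} [AddCommGroup N] [Module A N]

theorem card_quotient_smul_top [Finite N] (p : A) :
    Nat.card (N ⧸ (Ideal.span {p} • ⊤ : Submodule A N)) =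
      Nat.card (Submodule.torsionBy A N p) := by
  have hrange : (Ideal.span {p} • ⊤ : Submodule A N) = (DistribSMul.toLinearMap A N p).range := by
    ext x
    rw [Submodule.ideal_span_singleton_smul, Submodule.mem_smul_pointwise_iff_exists]
    simp
  have h1 := Submodule.card_eq_card_quotient_mul_card (Submodule.torsionBy A N p)
  have h2 := Submodule.card_eq_card_quotient_mul_card (DistribSMul.toLinearMap A N p).range
  have h3 : Nat.card (N ⧸ Submodule.torsionBy A N p) =
      Nat.card (DistribSMul.toLinearMap A N p).range :=
    Nat.card_congr (DistribSMul.toLinearMap A N p).quotKerEquivRange.toEquiv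
  rw [h3, mul_comm, h2] at h1
  rw [hrange]
  exact Nat.eq_of_mul_eq_mul_left Nat.card_pos h1

/-- If the `p`-torsion of a finite module has the size of `(A/p)^r`, then so has the quotient
modulo `p`, whence `r` elements generate the module modulo `p`. -/
theorem exists_generators_mod [IsPrincipalIdealRing A] [Finite N] {r : ℕ} {p : A}
    (hp : Irreducible p) [Finite (A ⧸ Ideal.span {p})]
    (hcard : Nat.card (Submodule.torsionBy A N p) = Nat.card (A ⧸ Ideal.span {p}) ^ r) :
    ∃ m : Fin r → N, ∀ x, ∃ c : Fin r → A,
      x - ∑ i, c i • m i ∈ (Ideal.span {p} • ⊤ : Submodule A N) := by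
  have := PrincipalIdealRing.isMaximal_of_irreducible hp
  let _ : Field (A ⧸ Ideal.span {p}) := Ideal.Quotient.field _
  set Q := N ⧸ (Ideal.span {p} • ⊤ : Submodule A N)
  have hrank : Module.finrank (A ⧸ Ideal.span {p}) Q = r := by
    have h := Module.natCard_eq_pow_finrank (K := A ⧸ Ideal.span {p}) (V := Q)
    rw [show Nat.card Q = _ from card_quotient_smul_top p, hcard] at h
    exact (Nat.pow_right_injective Finite.one_lt_card h).symm
  let b := Module.finBasisOfFinrankEq _ _ hrank
  choose m hm using fun i => Submodule.mkQ_surjective (Ideal.span {p} • ⊤ : Submodule A N) (b i)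
  refine ⟨m, fun x => ?_⟩
  choose c hc using fun i =>
    Ideal.Quotient.mk_surjective (b.repr (Submodule.Quotient.mk x) i)
  refine ⟨c, ?_⟩
  rw [← Submodule.Quotient.mk_eq_zero, ← Submodule.mkQ_apply, map_sub, map_sum, sub_eq_zero,
    Submodule.mkQ_apply, ← b.sum_repr (Submodule.Quotient.mk x)]
  refine Finset.sum_congr rfl fun i _ => ?_
  rw [map_smul, hm, ← hc]
  rfl

/-- Generators modulo the prime factors of `a` are glued to generators modulo `a` by the Chinese
remainder theorem. -/
theorem exists_surjective_of_card_torsionBy [IsDomain A] [IsPrincipalIdealRing A] [Finite N]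
    {r : ℕ} {a : A} (ha : a ≠ 0) (hN : ∀ x : N, a • x = 0)
    (hfin : ∀ p : A, p ∣ a → Finite (A ⧸ Ideal.span {p}))
    (hcard : ∀ p : A, p ∣ a →
      Nat.card (Submodule.torsionBy A N p) = Nat.card (A ⧸ Ideal.span {p}) ^ r) :
    ∃ m : Fin r → N, Submodule.span A (Set.range m) = ⊤ := by
  classical
  let ι := {I : Ideal A // ∃ p, p ∈ UniqueFactorizationMonoid.factors a ∧ I = Ideal.span {p}}
  have hι : Finite ι := by
    refine Set.Finite.subset
      (((UniqueFactorizationMonoid.factors a).toFinset.image fun p => Ideal.span {p}).finite_toSet)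
      (s := {I : Ideal A | _}) ?_
    rintro I ⟨p, hp, rfl⟩
    exact Finset.mem_coe.2 (Finset.mem_image.2 ⟨p, Multiset.mem_toFinset.2 hp, rfl⟩)
  let _ : Fintype ι := Fintype.ofFinite ι
  have hgen : ∀ I : ι, ∃ m : Fin r → N, ∀ x, ∃ c : Fin r → A,
      x - ∑ i, c i • m i ∈ (I.1 • ⊤ : Submodule A N) := by
    rintro ⟨_, p, hp, rfl⟩
    have hpa := UniqueFactorizationMonoid.dvd_of_mem_factors hp
    have := hfin p hpa
    exact exists_generators_mod (UniqueFactorizationMonoid.irreducible_of_factor p hp)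
      (hcard p hpa)
  choose m hm using hgen
  have hcop : Pairwise (Function.onFun IsCoprime fun I : ι => I.1) := by
    rintro ⟨_, p, hp, rfl⟩ ⟨_, p', hp', rfl⟩ hne
    have h1 := PrincipalIdealRing.isMaximal_of_irreducible
      (UniqueFactorizationMonoid.irreducible_of_factor p hp)
    have h2 := PrincipalIdealRing.isMaximal_of_irreducible
      (UniqueFactorizationMonoid.irreducible_of_factor p' hp')
    exact Ideal.isCoprime_of_isMaximal fun h => hne (Subtype.ext h)
  choose e he using fun I : ι =>
    Ideal.exists_forall_sub_mem_ideal hcop (fun J => if J = I then 1 else 0)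
  set m' : Fin r → N := fun i => ∑ I, e I • m I i with hm'
  refine ⟨m', ?_⟩
  have hmm : ∀ (I : ι) i, m I i - m' i ∈ (I.1 • ⊤ : Submodule A N) := by
    intro I i
    have h : m' i - m I i = ∑ J, (e J - if I = J then 1 else 0) • m J i := by
      simp_rw [sub_smul, Finset.sum_sub_distrib, ite_smul, one_smul, zero_smul]
      rw [Finset.sum_ite_eq Finset.univ I]
      simp [hm']
    rw [← neg_sub, h]
    exact neg_mem (sum_mem fun J _ => Submodule.smul_mem_smul (he J I) trivial)
  set R := Submodule.span A (Set.range m') with hR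
  have hmod : ∀ (I : ι) (x : N), ∃ c : Fin r → A,
      x - ∑ i, c i • m' i ∈ (I.1 • ⊤ : Submodule A N) := by
    intro I x
    obtain ⟨c, hc⟩ := hm I x
    refine ⟨c, ?_⟩
    rw [← sub_add_sub_cancel x (∑ i, c i • m I i), ← Finset.sum_sub_distrib]
    refine add_mem hc (sum_mem fun i _ => ?_)
    rw [← smul_sub]
    exact Submodule.smul_mem _ _ (hmm I i)
  have hstep : ∀ p ∈ UniqueFactorizationMonoid.factors a, ∀ x : N, ∃ y, x - p • y ∈ R := by
    intro p hp x
    obtain ⟨c, h⟩ := hmod ⟨_, p, hp, rfl⟩ x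
    rw [Submodule.ideal_span_singleton_smul, Submodule.mem_smul_pointwise_iff_exists] at h
    obtain ⟨y, -, hy⟩ := h
    refine ⟨y, ?_⟩
    rw [hy, sub_sub_cancel]
    exact sum_mem fun i _ => Submodule.smul_mem _ _ (Submodule.subset_span ⟨i, rfl⟩)
  have hprod : ∀ s : Multiset A, s ≤ UniqueFactorizationMonoid.factors a →
      ∀ x : N, ∃ y, x - s.prod • y ∈ R := by
    intro s
    induction s using Multiset.induction with
    | empty => exact fun _ x => ⟨x, by simp⟩
    | cons p s ih =>
      intro hs x
      obtain ⟨y, hy⟩ := ih ((Multiset.le_cons_self s p).trans hs) x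
      obtain ⟨z, hz⟩ := hstep p (Multiset.mem_of_le hs (Multiset.mem_cons_self p s)) y
      refine ⟨z, ?_⟩
      have h : x - (p ::ₘ s).prod • z = (x - s.prod • y) + s.prod • (y - p • z) := by
        rw [Multiset.prod_cons, smul_sub, smul_smul, mul_comm]
        abel
      rw [h]
      exact add_mem hy (Submodule.smul_mem _ _ hz)
  rw [Submodule.eq_top_iff']
  intro x
  obtain ⟨y, hy⟩ := hprod _ le_rfl x
  obtain ⟨w, hw⟩ := (UniqueFactorizationMonoid.factors_prod ha).symm
  rw [← hw, mul_comm, mul_smul, hN, smul_zero, sub_zero] at hy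
  exact hy

/-- A module whose `b`-torsion has the size of `(A/b)^r` for all `b ≠ 0` has `a`-torsion free of
rank `r` over `A/a`: a surjection from `(A/a)^r` is bijective by counting. -/
theorem nonempty_torsionBy_equiv [IsDomain A] [IsPrincipalIdealRing A] {r : ℕ}
    (hfin : ∀ a : A, a ≠ 0 → Finite (A ⧸ Ideal.span {a}))
    (hcard : ∀ a : A, a ≠ 0 →
      Nat.card (Submodule.torsionBy A N a) = Nat.card (A ⧸ Ideal.span {a}) ^ r)
    {a : A} (ha : a ≠ 0) :
    Nonempty (Submodule.torsionBy A N a ≃ₗ[A ⧸ Ideal.span {a}]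
      (Fin r → A ⧸ Ideal.span {a})) := by
  have := hfin a ha
  have hpos : 0 < Nat.card (Submodule.torsionBy A N a) := by
    rw [hcard a ha]
    exact pow_pos Nat.card_pos r
  have : Finite (Submodule.torsionBy A N a) := (Nat.card_pos_iff.1 hpos).2
  obtain ⟨m, hm⟩ := exists_surjective_of_card_torsionBy (N := Submodule.torsionBy A N a) (r := r)
    ha (Submodule.smul_torsionBy a)
    (fun p hp => hfin p (ne_zero_of_dvd_ne_zero ha hp)) (fun p hp => by
      rw [← hcard p (ne_zero_of_dvd_ne_zero ha hp)]
      refine Nat.card_congr ⟨fun x => ⟨x.1.1, ?_⟩, fun x => ⟨⟨x.1, ?_⟩, ?_⟩, ?_, ?_⟩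
      · exact congrArg Subtype.val ((Submodule.mem_torsionBy_iff p x.1).1 x.2)
      · obtain ⟨b, rfl⟩ := hp
        rw [Submodule.mem_torsionBy_iff, mul_comm, mul_smul,
          (Submodule.mem_torsionBy_iff p x.1).1 x.2, smul_zero]
      · exact (Submodule.mem_torsionBy_iff p _).2
          (Subtype.ext ((Submodule.mem_torsionBy_iff p x.1).1 x.2))
      · exact fun x => rfl
      · exact fun x => rfl)
  let f := Fintype.linearCombination (A ⧸ Ideal.span {a}) m
  have hf : Function.Surjective f := by
    rw [← LinearMap.range_eq_top, Fintype.range_linearCombination, Submodule.eq_top_iff']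
    intro x
    have hx : x ∈ Submodule.span A (Set.range m) := hm ▸ trivial
    exact Submodule.span_subset_span A (A ⧸ Ideal.span {a}) _ hx
  have hbij : Function.Bijective f := by
    rw [Nat.bijective_iff_surjective_and_card]
    exact ⟨hf, by rw [Nat.card_fun, hcard a ha, Nat.card_fin]⟩
  exact ⟨(LinearEquiv.ofBijective f hbij).symm⟩

end Counting

/-! ### The action of `t` on the points of `G_{s,u}` in coordinates -/

section Coordinates

variable {Fq : Type*} [Field Fq] [Fintype Fq] {K : Type*} [Field K] [Algebra Fq K] {θ : K}
  {r : ℕ} {s : Fin r → ℕ} {u : Fin r → K}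

theorem blockDim_pos (hs : ∀ i, 0 < s i) (l : Fin r) : 0 < blockDim s l :=
  (hs l).trans_le (Finset.single_le_sum (f := s) (fun _ _ => Nat.zero_le _)
    (Finset.mem_Ici.2 le_rfl))

/-- The first index of the `l`-th block. -/
def blockHead (hs : ∀ i, 0 < s i) (l : Fin r) : BlockIdx s := ⟨l, ⟨0, blockDim_pos hs l⟩⟩

/-- The possibly nonzero entry of the block `E[lm]`, an entry of a unipotent upper triangular
matrix of size `r`. -/
def cornerE (u : Fin r → K) (l m : Fin r) : K :=
  if l ≤ m then (-1) ^ ((m : ℕ) - (l : ℕ)) * ∏ e ∈ Finset.Ico l m, u e else 0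

theorem cornerE_self (l : Fin r) : cornerE u l l = 1 := by simp [cornerE]

theorem cornerE_of_lt {l m : Fin r} (h : m < l) : cornerE u l m = 0 := if_neg (not_le.2 h)

theorem matToEnd_matT_apply (x : BlockIdx s → K) (i : BlockIdx s) :
    matToEnd Fq K _ (matT s u Fq θ) x i =
      θ * x i + ∑ j, matN s i j * x j + ∑ j, matE s u i j * x j ^ Fintype.card Fq := by
  have h : ∀ j, TwistedPoly.toEnd Fq K (matT s u Fq θ i j) (x j) =
      (θ • (1 : Matrix (BlockIdx s) (BlockIdx s) K)) i j * x j + matN s i j * x j +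
        matE s u i j * x j ^ Fintype.card Fq := by
    intro j
    rw [matT, Matrix.add_apply, Matrix.map_apply, Matrix.map_apply, map_add, LinearMap.add_apply,
      TwistedPoly.toEnd_monomial, TwistedPoly.toEnd_monomial, pow_zero, pow_one, pow_one,
      Matrix.add_apply, add_mul]
  rw [matToEnd_apply]
  simp_rw [h, Finset.sum_add_distrib]
  congr 2
  rw [Finset.sum_eq_single i]
  · simp
  · intro j _ hj
    simp [Matrix.one_apply_ne hj.symm]
  · simp

theorem sum_matN_mul_of_lt (x : BlockIdx s → K) {l : Fin r} {i : ℕ} (h : i + 1 < blockDim s l) :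
    ∑ j, matN s ⟨l, ⟨i, Nat.lt_of_succ_lt h⟩⟩ j * x j = x ⟨l, ⟨i + 1, h⟩⟩ := by
  rw [Finset.sum_eq_single ⟨l, ⟨i + 1, h⟩⟩]
  · simp [matN]
  · rintro ⟨m, j⟩ _ hj
    rw [matN, if_neg, zero_mul]
    rintro ⟨rfl, h2⟩
    exact hj (congrArg _ (Fin.ext h2.symm))
  · simp

theorem sum_matN_mul_of_eq (x : BlockIdx s → K) {i : BlockIdx s}
    (h : (i.2 : ℕ) + 1 = blockDim s i.1) : ∑ j, matN s i j * x j = 0 := by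
  refine Finset.sum_eq_zero fun j _ => ?_
  rw [matN, if_neg, zero_mul]
  rintro ⟨h1, h2⟩
  have h3 := congrArg (blockDim s) h1
  have h4 := j.2.isLt
  omega

theorem sum_matE_mul_of_ne (x : BlockIdx s → K) {i : BlockIdx s}
    (h : (i.2 : ℕ) + 1 ≠ blockDim s i.1) : ∑ j, matE s u i j * x j = 0 := by
  refine Finset.sum_eq_zero fun j _ => ?_
  rw [matE, if_neg, zero_mul]
  exact fun h' => h h'.2.1

theorem sum_matE_mul_of_eq (hs : ∀ i, 0 < s i) (x : BlockIdx s → K) {i : BlockIdx s}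
    (h : (i.2 : ℕ) + 1 = blockDim s i.1) :
    ∑ j, matE s u i j * x j = ∑ m, cornerE u i.1 m * x (blockHead hs m) := by
  rw [Fintype.sum_sigma]
  refine Finset.sum_congr rfl fun m _ => ?_
  rw [Finset.sum_eq_single ⟨0, blockDim_pos hs m⟩]
  · simp [matE, cornerE, h, blockHead]
  · intro j _ hj
    rw [matE, if_neg, zero_mul]
    rintro ⟨-, -, h2⟩
    exact hj (Fin.ext h2)
  · simp

theorem coord_X_smul (x : (tModuleG s u Fq θ).Points) :
    (tModuleG s u Fq θ).coord ((Polynomial.X : Fq[X]) • x) =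
      matToEnd Fq K _ (matT s u Fq θ) ((tModuleG s u Fq θ).coord x) := by
  rw [TModule.coord_smul]
  congr 2
  exact Polynomial.aeval_X _

theorem coord_C_smul (c : Fq) (x : (tModuleG s u Fq θ).Points) :
    (tModuleG s u Fq θ).coord ((Polynomial.C c : Fq[X]) • x) =
      c • (tModuleG s u Fq θ).coord x := by
  have h : (tModuleG s u Fq θ).op (Polynomial.C c) = algebraMap Fq _ c :=
    (tModuleG s u Fq θ).op.commutes c
  rw [TModule.coord_smul, h, AlgHom.commutes]
  rfl

theorem matToEnd_matT_apply_of_lt (x : BlockIdx s → K) {l : Fin r} {i : ℕ}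
    (h : i + 1 < blockDim s l) :
    matToEnd Fq K _ (matT s u Fq θ) x ⟨l, ⟨i, Nat.lt_of_succ_lt h⟩⟩ =
      θ * x ⟨l, ⟨i, Nat.lt_of_succ_lt h⟩⟩ + x ⟨l, ⟨i + 1, h⟩⟩ := by
  rw [matToEnd_matT_apply, sum_matN_mul_of_lt x h,
    sum_matE_mul_of_ne (fun j => x j ^ Fintype.card Fq) h.ne, add_zero]

theorem matToEnd_matT_apply_of_eq (hs : ∀ i, 0 < s i) (x : BlockIdx s → K) {i : BlockIdx s}
    (h : (i.2 : ℕ) + 1 = blockDim s i.1) :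
    matToEnd Fq K _ (matT s u Fq θ) x i =
      θ * x i + ∑ m, cornerE u i.1 m * x (blockHead hs m) ^ Fintype.card Fq := by
  rw [matToEnd_matT_apply, sum_matN_mul_of_eq x h,
    sum_matE_mul_of_eq hs (fun j => x j ^ Fintype.card Fq) h, add_zero]

end Coordinates

/-! ### The Frobenius equation satisfied by torsion points -/

section FrobeniusEquation

variable {Fq : Type*} [Field Fq] {K : Type*} [Field K] [Algebra Fq K]
  {B : Type*} [CommRing B] [Algebra Fq B]

/-- The operator `t - θ` on the `𝔽_q`-linear maps `B → K`, where `t ∈ B` acts by translation of the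
argument and `θ ∈ K` by multiplication of the value. -/
def subTheta (t : B) (θ : K) : (B →ₗ[Fq] K) →ₗ[K] (B →ₗ[Fq] K) where
  toFun f := f ∘ₗ LinearMap.mulLeft Fq t - θ • f
  map_add' f g := by
    ext b
    simp
    ring
  map_smul' c f := by
    ext b
    simp
    ring

theorem subTheta_apply (t : B) (θ : K) (f : B →ₗ[Fq] K) (b : B) :
    subTheta t θ f b = f (t * b) - θ * f b := rfl

/-- If `f` is an eigenvector of `t` with eigenvalue `θ`, then `a(t) = 0` forces `a(θ) = 0`. -/
theorem subTheta_injective {t : B} {θ : K} {a : Fq[X]} (ha : Polynomial.aeval t a = 0)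
    (hθ : Polynomial.aeval θ a ≠ 0) : Function.Injective (subTheta (Fq := Fq) t θ) := by
  rw [injective_iff_map_eq_zero]
  intro f hf
  have h1 : ∀ b, f (t * b) = θ * f b := fun b => by
    rw [← sub_eq_zero, ← subTheta_apply, hf, LinearMap.zero_apply]
  have h2 : ∀ (p : Fq[X]) (b : B), f (Polynomial.aeval t p * b) = Polynomial.aeval θ p * f b := by
    intro p
    induction p using Polynomial.induction_on with
    | C c =>
      intro b
      rw [Polynomial.aeval_C, Polynomial.aeval_C, ← Algebra.smul_def, ← Algebra.smul_def, map_smul]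
    | add p p' hp hp' =>
      intro b
      rw [map_add, map_add, add_mul, add_mul, map_add, hp, hp']
    | monomial n c ih =>
      intro b
      rw [pow_succ, ← mul_assoc, map_mul (Polynomial.aeval t), map_mul (Polynomial.aeval θ),
        mul_assoc, ih, Polynomial.aeval_X, Polynomial.aeval_X, h1, mul_assoc]
  ext b
  have h3 := h2 a b
  rw [ha, zero_mul, map_zero] at h3
  exact (mul_eq_zero.1 h3.symm).resolve_left hθ

variable [Fintype Fq]

/-- Composition with the `q`-th power Frobenius of `K`. -/
def frobComp : (B →ₗ[Fq] K) →+ (B →ₗ[Fq] K) where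
  toFun f := (FiniteField.frobeniusAlgHom Fq K).toLinearMap ∘ₗ f
  map_zero' := LinearMap.comp_zero _
  map_add' _ _ := LinearMap.comp_add _ _ _

theorem frobComp_apply (f : B →ₗ[Fq] K) (b : B) : frobComp f b = f b ^ Fintype.card Fq := rfl

theorem frobComp_smul (c : K) (f : B →ₗ[Fq] K) :
    frobComp (c • f) = c ^ Fintype.card Fq • frobComp f := by
  ext b
  simp [frobComp_apply, mul_pow]

variable {r : ℕ} (u : Fin r → K)

/-- The action of the unipotent matrix `cornerE u` on column vectors. -/
def cornerMul (D : Type*) [AddCommGroup D] [Module K D] : (Fin r → D) →ₗ[K] (Fin r → D) :=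
  LinearMap.pi fun l => ∑ m, cornerE u l m • LinearMap.proj m

theorem cornerMul_apply {D : Type*} [AddCommGroup D] [Module K D] (F : Fin r → D) (l : Fin r) :
    cornerMul u D F l = ∑ m, cornerE u l m • F m := by
  simp [cornerMul]

theorem cornerMul_injective (D : Type*) [AddCommGroup D] [Module K D] :
    Function.Injective (cornerMul u D) := by
  rw [injective_iff_map_eq_zero]
  intro F hF
  funext l
  induction l using WellFoundedGT.induction with
  | ind l ih =>
    have h := congrFun hF l
    rw [cornerMul_apply, Finset.sum_eq_single l, cornerE_self, one_smul] at h
    · exact h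
    · intro m _ hm
      obtain hlt | hlt := lt_or_gt_of_ne hm
      · rw [cornerE_of_lt hlt, zero_smul]
      · rw [ih m hlt, Pi.zero_apply, smul_zero]
    · simp

/-- The solutions of the Frobenius equation: tuples `F` with
`(t - θ) ^ n_l F_l = ∑ₘ cornerE u l m • Frob F_m` for all `l`. -/
def frobSolutions (t : B) (θ : K) (n : Fin r → ℕ) : Set (Fin r → (B →ₗ[Fq] K)) :=
  {F | ∀ l, (subTheta t θ ^ n l) (F l) = ∑ m, cornerE u l m • frobComp (F m)}

theorem card_frobSolutions [IsAlgClosed K] [FiniteDimensional Fq B] {t : B} {θ : K}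
    (hinj : Function.Injective (subTheta (Fq := Fq) t θ)) (n : Fin r → ℕ) :
    Nat.card (frobSolutions (Fq := Fq) u t θ n) =
      Fintype.card Fq ^ (r * Module.finrank Fq B) := by
  set Δ : (Fin r → (B →ₗ[Fq] K)) →ₗ[K] (Fin r → (B →ₗ[Fq] K)) :=
    LinearMap.pi fun l => (subTheta t θ ^ n l) ∘ₗ LinearMap.proj l with hΔ
  have hΔinj : Function.Injective Δ := by
    intro F F' h
    funext l
    have h1 := congrFun h l
    have h2 : Function.Injective (subTheta (Fq := Fq) t θ ^ n l) := by
      rw [Module.End.coe_pow]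
      exact hinj.iterate _
    exact h2 h1
  let e := LinearEquiv.ofInjectiveEndo Δ hΔinj
  let φ : (Fin r → (B →ₗ[Fq] K)) →+ (Fin r → (B →ₗ[Fq] K)) :=
    ((e.symm.toLinearMap ∘ₗ cornerMul u _).toAddMonoidHom).comp
      (frobComp.compLeft (Fin r))
  have hφ : ∀ F, φ F = e.symm (cornerMul u _ fun l => frobComp (F l)) := fun F => rfl
  have hset : frobSolutions (Fq := Fq) u t θ n = fixedSet φ := by
    ext F
    change _ ↔ φ F = F
    rw [hφ, LinearEquiv.symm_apply_eq, eq_comm, funext_iff]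
    refine forall_congr' fun l => ?_
    rw [cornerMul_apply]
    rfl
  have hsmul : ∀ (c : K) (F : Fin r → (B →ₗ[Fq] K)), φ (c • F) = c ^ Fintype.card Fq • φ F := by
    intro c F
    rw [hφ, hφ, ← map_smul, ← map_smul]
    congr 2
    funext l
    exact frobComp_smul c (F l)
  have hφinj : Function.Injective φ := by
    rw [injective_iff_map_eq_zero]
    intro F hF
    rw [hφ] at hF
    have h1 := cornerMul_injective u _
      ((e.symm.injective (hF.trans (map_zero _).symm)).trans (map_zero _).symm)
    funext l
    ext b
    exact eq_zero_of_pow_eq_zero (LinearMap.congr_fun (congrFun h1 l) b)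
  rw [hset, card_fixedSet φ hsmul hφinj, Module.finrank_pi_fintype, Finset.sum_const,
    Finset.card_univ, Fintype.card_fin, smul_eq_mul, Module.finrank_linearMap,
    Module.finrank_self, mul_one]

end FrobeniusEquation

/-! ### Torsion points as solutions of the Frobenius equation -/

section Torsion

open Polynomial

variable {Fq : Type*} [Field Fq] [Fintype Fq] {K : Type*} [Field K] [Algebra Fq K] {θ : K}
  {r : ℕ} {s : Fin r → ℕ} {u : Fin r → K} {a : Fq[X]}

/-- The `𝔽_q[t]`-linear map `b ↦ b • x` on `𝔽_q[t]/(a)` attached to an `a`-torsion point `x`. -/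
noncomputable def torsionHom (x : Submodule.torsionBy Fq[X] (tModuleG s u Fq θ).Points a) :
    (Fq[X] ⧸ Ideal.span {a}) →ₗ[Fq[X]] (tModuleG s u Fq θ).Points :=
  Submodule.liftQ _ (LinearMap.toSpanSingleton Fq[X] _ x.1) <| by
    rw [Ideal.span, Submodule.span_le, Set.singleton_subset_iff]
    exact (Submodule.mem_torsionBy_iff a x.1).1 x.2

theorem torsionHom_mk (x : Submodule.torsionBy Fq[X] (tModuleG s u Fq θ).Points a) (b : Fq[X]) :
    torsionHom x (Ideal.Quotient.mk _ b) = b • x.1 := rfl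

/-- The coordinate functions of `torsionHom x`. -/
noncomputable def torsionCoord
    (x : Submodule.torsionBy Fq[X] (tModuleG s u Fq θ).Points a) (i : BlockIdx s) :
    (Fq[X] ⧸ Ideal.span {a}) →ₗ[Fq] K where
  toFun b := (tModuleG s u Fq θ).coord (torsionHom x b) i
  map_add' b c := by rw [map_add, map_add, Pi.add_apply]
  map_smul' c b := by
    have h : c • b = (C c : Fq[X]) • b := by
      rw [← algebraMap_eq, algebraMap_smul]
    rw [h, map_smul, coord_C_smul, Pi.smul_apply, RingHom.id_apply]

theorem torsionCoord_X_mul (x : Submodule.torsionBy Fq[X] (tModuleG s u Fq θ).Points a)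
    (b : Fq[X] ⧸ Ideal.span {a}) (i : BlockIdx s) :
    torsionCoord x i (Ideal.Quotient.mk _ X * b) =
      matToEnd Fq K _ (matT s u Fq θ) (fun j => torsionCoord x j b) i := by
  change (tModuleG s u Fq θ).coord (torsionHom x ((X : Fq[X]) • b)) i = _
  rw [map_smul, coord_X_smul]
  rfl

/-- All coordinates of a torsion point are determined by the heads of the blocks: along a block,
the next coordinate function is obtained by applying `t - θ`. -/
theorem subTheta_pow_torsionCoord (hs : ∀ i, 0 < s i)
    (x : Submodule.torsionBy Fq[X] (tModuleG s u Fq θ).Points a) (l : Fin r) (i : ℕ)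
    (hi : i < blockDim s l) :
    (subTheta (Ideal.Quotient.mk _ X) θ ^ i) (torsionCoord x (blockHead hs l)) =
      torsionCoord x ⟨l, ⟨i, hi⟩⟩ := by
  induction i with
  | zero => rfl
  | succ i ih =>
    refine LinearMap.ext fun b => ?_
    rw [pow_succ', Module.End.mul_apply, ih (Nat.lt_of_succ_lt hi), subTheta_apply,
      torsionCoord_X_mul, matToEnd_matT_apply_of_lt _ hi, add_sub_cancel_left]

theorem torsionCoord_mem_frobSolutions (hs : ∀ i, 0 < s i)
    (x : Submodule.torsionBy Fq[X] (tModuleG s u Fq θ).Points a) :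
    (fun l => torsionCoord x (blockHead hs l)) ∈
      frobSolutions (Fq := Fq) u (Ideal.Quotient.mk (Ideal.span {a}) X) θ (blockDim s) := by
  intro l
  have hpos := blockDim_pos hs l
  have hd : blockDim s l - 1 + 1 = blockDim s l := by omega
  refine LinearMap.ext fun b => ?_
  rw [← hd, pow_succ', Module.End.mul_apply,
    subTheta_pow_torsionCoord hs x l _ (by omega), subTheta_apply, torsionCoord_X_mul,
    matToEnd_matT_apply_of_eq hs _ hd, add_sub_cancel_left, LinearMap.sum_apply]
  rfl

/-- A solution of the Frobenius equation comes from the torsion point whose coordinates are the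
values at `1` of the functions `(t - θ) ^ i F_l`. -/
theorem exists_torsionCoord_eq (hs : ∀ i, 0 < s i) {F : Fin r → (Fq[X] ⧸ Ideal.span {a} →ₗ[Fq] K)}
    (hF : F ∈ frobSolutions (Fq := Fq) u (Ideal.Quotient.mk (Ideal.span {a}) X) θ (blockDim s)) :
    ∃ x : Submodule.torsionBy Fq[X] (tModuleG s u Fq θ).Points a,
      (fun l => torsionCoord x (blockHead hs l)) = F := by
  let H : (Fq[X] ⧸ Ideal.span {a}) → BlockIdx s → K := fun b i =>
    (subTheta (Ideal.Quotient.mk _ X) θ ^ (i.2 : ℕ)) (F i.1) b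
  have hX : ∀ b, H (Ideal.Quotient.mk _ X * b) = matToEnd Fq K _ (matT s u Fq θ) (H b) := by
    intro b
    have hsub : ∀ (i : ℕ) (l : Fin r),
        (subTheta (Ideal.Quotient.mk _ X) θ ^ i) (F l) (Ideal.Quotient.mk _ X * b) =
          θ * (subTheta (Ideal.Quotient.mk _ X) θ ^ i) (F l) b +
            (subTheta (Ideal.Quotient.mk _ X) θ ^ (i + 1)) (F l) b := by
      intro i l
      rw [pow_succ', Module.End.mul_apply, subTheta_apply, add_sub_cancel]
    funext ⟨l, ⟨i, hi⟩⟩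
    obtain hlt | heq := lt_or_eq_of_le (Nat.succ_le_of_lt hi)
    · rw [matToEnd_matT_apply_of_lt _ hlt]
      exact hsub i l
    · rw [matToEnd_matT_apply_of_eq hs _ heq]
      refine (hsub i l).trans ?_
      rw [← Nat.succ_eq_add_one, heq, hF l, LinearMap.sum_apply]
      rfl
  let x : (tModuleG s u Fq θ).Points := (tModuleG s u Fq θ).coord.symm (H 1)
  have hsmul : ∀ (c : Fq[X]), (tModuleG s u Fq θ).coord (c • x) = H (Ideal.Quotient.mk _ c) := by
    intro c
    induction c using Polynomial.induction_on with
    | C c =>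
      have h1 : (Ideal.Quotient.mk (Ideal.span {a})) (C c) = c • 1 := by
        rw [← algebraMap_eq, ← Ideal.Quotient.algebraMap_eq,
          ← IsScalarTower.algebraMap_apply, Algebra.algebraMap_eq_smul_one]
      rw [coord_C_smul, AddEquiv.apply_symm_apply, h1]
      funext i
      exact (map_smul _ c _).symm
    | add p p' hp hp' =>
      rw [add_smul, map_add, hp, hp', map_add]
      funext i
      exact (map_add _ _ _).symm
    | monomial n c ih =>
      rw [pow_succ, ← mul_assoc, mul_comm _ X, mul_smul, coord_X_smul, ih, ← hX, ← map_mul]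
  refine ⟨⟨x, ?_⟩, ?_⟩
  · rw [Submodule.mem_torsionBy_iff]
    refine (tModuleG s u Fq θ).coord.injective ?_
    rw [hsmul, Ideal.Quotient.eq_zero_iff_mem.2 (Ideal.mem_span_singleton_self a), map_zero]
    funext i
    exact map_zero _
  · refine funext fun l => LinearMap.ext fun b => ?_
    obtain ⟨c, rfl⟩ := Ideal.Quotient.mk_surjective b
    exact congrFun (hsmul c) (blockHead hs l)

theorem finite_quotient_span {F : Type*} [Field F] {a : F[X]} (ha : a ≠ 0) : 
    Module.Finite F (F[X] ⧸ Ideal.span {a}) :=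
  (AdjoinRoot.powerBasis ha).finite

/-- The `a`-torsion of `G_{s,u}` has the size of `(𝔽_q[t]/(a))^r`: its points correspond to the
solutions of the Frobenius equation, in which `t - θ` is injective because `a(θ) ≠ 0`. -/
theorem card_torsionBy [IsAlgClosed K] (hs : ∀ i, 0 < s i) (hθ : Transcendental Fq θ)
    (ha : a ≠ 0) :
    Nat.card (Submodule.torsionBy Fq[X] (tModuleG s u Fq θ).Points a) =
      Nat.card (Fq[X] ⧸ Ideal.span {a}) ^ r := by
  have := finite_quotient_span ha
  let f : Submodule.torsionBy Fq[X] (tModuleG s u Fq θ).Points a →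
      frobSolutions (Fq := Fq) u (Ideal.Quotient.mk (Ideal.span {a}) X) θ (blockDim s) :=
    fun x => ⟨_, torsionCoord_mem_frobSolutions hs x⟩
  have hf : Function.Bijective f := by
    constructor
    · intro x y hxy
      have h1 : ∀ l, torsionCoord x (blockHead hs l) = torsionCoord y (blockHead hs l) :=
        fun l => congrFun (congrArg Subtype.val hxy) l
      have h2 : ∀ i, torsionCoord x i = torsionCoord y i := by
        rintro ⟨l, i⟩
        rw [← subTheta_pow_torsionCoord hs x l i i.2, h1, subTheta_pow_torsionCoord hs y l i i.2]
      refine Subtype.ext ((tModuleG s u Fq θ).coord.injective (funext fun i => ?_))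
      have h3 := LinearMap.congr_fun (h2 i) (Ideal.Quotient.mk _ 1)
      rw [← one_smul Fq[X] x.1, ← one_smul Fq[X] y.1]
      exact h3
    · rintro ⟨F, hF⟩
      obtain ⟨x, hx⟩ := exists_torsionCoord_eq hs hF
      exact ⟨x, Subtype.ext hx⟩
  have hroot : aeval (Ideal.Quotient.mk (Ideal.span {a}) X) a = 0 := by
    have h := aeval_algHom_apply (Ideal.Quotient.mkₐ Fq (Ideal.span {a})) X a
    rw [aeval_X_left_apply] at h
    exact h.trans (Ideal.Quotient.eq_zero_iff_mem.2 (Ideal.mem_span_singleton_self a))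
  have hθa : aeval θ a ≠ 0 := fun h => ha ((transcendental_iff.1 hθ) a h)
  rw [Nat.card_congr (Equiv.ofBijective f hf),
    card_frobSolutions u (subTheta_injective hroot hθa),
    Module.natCard_eq_pow_finrank (K := Fq) (V := Fq[X] ⧸ Ideal.span {a}),
    Nat.card_eq_fintype_card, ← pow_mul, mul_comm]

theorem isRegular_tModuleG [IsAlgClosed K] (hr : 0 < r) (hs : ∀ i, 0 < s i)
    (hθ : Transcendental Fq θ) : (tModuleG s u Fq θ).IsRegular := by
  refine ⟨r, hr, fun a ha => nonempty_torsionBy_equiv (fun b hb => ?_)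
    (fun b hb => card_torsionBy hs hθ hb) ha⟩
  have := finite_quotient_span hb
  exact Module.finite_of_finite Fq

end Torsion

/-! ### The field `k̄` -/

section KBarField

universe w

variable (Fq : Type w) [Field Fq] [Fintype Fq]

/-- The algebraic closure of `k_∞` is algebraically closed and embeds into `ℂ_∞`, so every
polynomial over `k` splits in `ℂ_∞`, hence in `k̄`. -/
theorem isAlgClosed_KBar : IsAlgClosed (KBar Fq) := by
  have h1 : IsAlgClosed (KInfBar Fq) := IsAlgClosure.isAlgClosed (KInf Fq)
  refine (IsAlgClosure.of_splits (R := RatFunc Fq) (K := KBar Fq) fun p _ _ => ?_).isAlgClosed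
  refine _root_.Splits.algebraicClosure (F := RatFunc Fq) (E := CInf Fq) ?_
  have h2 : algebraMap (RatFunc Fq) (CInf Fq) = (algebraMap (KInfBar Fq) (CInf Fq)).comp
      ((algebraMap (KInf Fq) (KInfBar Fq)).comp (algebraMap (RatFunc Fq) (KInf Fq))) := rfl
  rw [h2, ← Polynomial.map_map]
  exact (IsAlgClosed.splits _).map _

theorem transcendental_thetaBar : Transcendental Fq (thetaBar Fq) := by
  rw [transcendental_iff]
  intro p hp
  have h : Polynomial.aeval (thetaBar Fq) p =
      algebraMap (RatFunc Fq) (KBar Fq) (algebraMap Fq[X] (RatFunc Fq) p) := by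
    have : IsScalarTower Fq (RatFunc Fq) (KBar Fq) := .of_algebraMap_eq fun _ => rfl
    rw [thetaBar, Polynomial.aeval_algebraMap_apply, ← RatFunc.algebraMap_X,
      Polynomial.aeval_algebraMap_apply, Polynomial.aeval_X_left_apply]
  rw [h, map_eq_zero] at hp
  exact RatFunc.algebraMap_injective Fq (hp.trans (map_zero _).symm)

end KBarField

end AndersonT

theorem proposition3p4 {Fq : Type*} [Field Fq] [Fintype Fq] {r : ℕ} (hr : 0 < r)
    (s : Fin r → ℕ) (hs : ∀ i, 0 < s i) (u : Fin r → AndersonT.KBar Fq)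
    (hu : (fun i => (u (Fin.rev i) : AndersonT.CInf Fq)) ∈
      AndersonT.domainInf Fq (fun i => s (Fin.rev i))) :
    (AndersonT.tModuleG s u Fq (AndersonT.thetaBar Fq)).IsRegular := by
  have := AndersonT.isAlgClosed_KBar Fq
  exact AndersonT.isRegular_tModuleG hr hs (AndersonT.transcendental_thetaBar Fq)
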